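/- For $f,g:\{0,1\}^n\to\{0,1\}$ let $\mathrm{dist}(f,g)=|\{x : f(x)\neq g(x)\}|$. Call $g$ a $k$-junta if it depends on at most $k$ of its $n$ variables, and call $f$ $\epsilon$-far from $k$-juntas if $\mathrm{dist}(f,g)\ge \epsilon 2^n$ for every $k$-junta $g:\{0,1\}^n\to\{0,1\}$. For $J\subseteq[n]$ let $\mathrm{Inf}_f(J)=\Pr_{x,y}[f(x)\neq f(x_{\overline J}\,y_J)]$, where $x,y\in\{0,1\}^n$ are independent and uniform and $x_{\overline J}\,y_J$ agrees with $y$ on $J$ and with $x$ on $\overline J=[n]\setminus J$. A random partition of $[n]$ into $r$ parts is obtained by placing each element of $[n]$, independently, in one of $r$ labelled parts chosen uniformly at random (parts may be empty). There is an absolute constant $c_0>0$ such that the following holds for every real $c\ge c_0$. Let $k\ge 1$ and $n\ge 0$ be integers such that $r=c\,k^2$ is an integer, let $\epsilon$ be a real number, let $f:\{0,1\}^n\to\{0,1\}$ be $\epsilon$-far from $k$-juntas, and let $\mathcal I$ be a random partition of $[n]$ into $r$ parts. Then with probability at least $5/6$ over the choice of $\mathcal I$, every union $J$ of $k$ of the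 $r$ parts of $\mathcal I$ satisfies $\mathrm{Inf}_f(\overline J)\ge \epsilon/4$. -/

import Mathlib

namespace JuntaTesting

open Classical in
/-- The probability of the event `p` under the uniform distribution on the finite type `Ω`. -/
noncomputable def unifProb {Ω : Type*} [Fintype Ω] (p : Ω → Prop) : ℝ :=
  ((Finset.univ.filter p).card : ℝ) / (Fintype.card Ω : ℝ)

/-- `f : {0,1}ⁿ → {0,1}` is a `k`-junta: it depends on at most `k` of its input variables. -/
def IsJunta {n : ℕ} (k : ℕ) (f : (Fin n → Bool) → Bool) : Prop :=
  ∃ S : Finset (Fin n), S.card ≤ k ∧ DependsOn f (S : Set (Fin n))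

/-- `f` is `ε`-far from the property `P`: it differs from every `g` in `P` on at least `ε * 2 ^ n`
inputs (`hammingDist f g` is the number of inputs `x` with `f x ≠ g x`). -/
def IsFar {n : ℕ} (ε : ℝ) (P : ((Fin n → Bool) → Bool) → Prop)
    (f : (Fin n → Bool) → Bool) : Prop :=
  ∀ g : (Fin n → Bool) → Bool, P g → ε * 2 ^ n ≤ (hammingDist f g : ℝ)

/-- The influence of the set `J` of variables in `f`: the probability, over independent uniform
`x` and `y`, that `f` changes its value when the coordinates of `x` in `J` are replaced by those
of `y` (`J.piecewise y x` is `y` on `J` and `x` off `J`). -/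
noncomputable def influence {n : ℕ} (f : (Fin n → Bool) → Bool) (J : Finset (Fin n)) : ℝ :=
  unifProb fun xy : (Fin n → Bool) × (Fin n → Bool) => f xy.1 ≠ f (J.piecewise xy.2 xy.1)

/-- A partition of `[n]` into `r` labelled, possibly empty parts, given by the label of the part
that contains each element. A uniformly random one places each element, independently of the
others, in a uniformly random part. -/
abbrev LabelledPartition (n r : ℕ) : Type := Fin n → Fin r

/-- The union of the parts of the partition `I` whose labels belong to `T`. -/
def unionOfParts {n r : ℕ} (I : LabelledPartition n r) (T : Finset (Fin r)) : Finset (Fin n) :=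
  Finset.univ.filter fun i => I i ∈ T

end JuntaTesting

/-! A union `J` of parts is bad if `influence f Jᶜ < ε / 4`. Two facts drive the proof: influence is
subadditive (`influence_union_le`), and `influence f Jᶜ ≥ ε` whenever `J` has at most `k` elements
(`IsFar.le_influence_compl`). If some `S` with at most `2k` elements has `influence f Sᶜ < ε / 2`, a
random partition very likely separates `S`. Then `J ∩ S` has at most `k` elements, and subadditivity
shows that `J` is not bad. Otherwise any two bad sets meet in at least `2k` elements, since the
complement of their intersection has influence below `ε / 2`. For fixed labels `T`, the union of
parts is a `k / r`-biased random set, and `CrossIntersecting.biasedMeasure_le` makes it bad with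
probability at most `(2k / r) ^ (2k)`. This beats the union bound over the `r.choose k` choices of
`T`. -/

namespace JuntaTesting

/-! ### Uniform probability on finite types. -/

section UniformProbability

variable {Ω Ω' : Type*} [Fintype Ω] [Fintype Ω']

open Classical in
lemma unifProb_eq_sum (p : Ω → Prop) :
    unifProb p = (∑ ω, if p ω then (1 : ℝ) else 0) / Fintype.card Ω := by
  simp [unifProb]

lemma unifProb_nonneg (p : Ω → Prop) : 0 ≤ unifProb p := by
  unfold unifProb; positivity

lemma unifProb_mono {p q : Ω → Prop} (h : ∀ ω, p ω → q ω) : unifProb p ≤ unifProb q := by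
  unfold unifProb
  gcongr with ω
  exact h ω

lemma unifProb_or_le (p q : Ω → Prop) :
    unifProb (fun ω => p ω ∨ q ω) ≤ unifProb p + unifProb q := by
  classical
  unfold unifProb
  rw [← add_div]
  gcongr
  norm_cast
  refine le_trans (Finset.card_le_card fun ω hω => ?_) (Finset.card_union_le _ _)
  simpa using hω

lemma unifProb_exists_le_sum {ι : Type*} (s : Finset ι) (p : ι → Ω → Prop) :
    unifProb (fun ω => ∃ i ∈ s, p i ω) ≤ ∑ i ∈ s, unifProb (p i) := by
  classical
  induction s using Finset.induction_on with
  | empty => simp [unifProb]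
  | insert a s ha ih =>
    rw [Finset.sum_insert ha]
    calc unifProb (fun ω => ∃ i ∈ insert a s, p i ω)
        ≤ unifProb (fun ω => p a ω ∨ ∃ i ∈ s, p i ω) :=
          unifProb_mono fun ω h => by simpa using h
      _ ≤ _ := (unifProb_or_le _ _).trans (by gcongr)

lemma unifProb_not [Nonempty Ω] (p : Ω → Prop) :
    unifProb (fun ω => ¬ p ω) = 1 - unifProb p := by
  classical
  have h := Finset.card_filter_add_card_filter_not (s := (Finset.univ : Finset Ω)) p
  have hc : (Fintype.card Ω : ℝ) ≠ 0 := by simp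
  unfold unifProb
  rw [eq_sub_iff_add_eq, ← add_div, div_eq_one_iff_eq hc, ← Finset.card_univ, ← h]
  push_cast
  rw [add_comm]
  congr!

lemma unifProb_comp_equiv (e : Ω ≃ Ω') (p : Ω' → Prop) :
    unifProb (fun ω => p (e ω)) = unifProb p := by
  classical
  rw [unifProb_eq_sum, unifProb_eq_sum, Fintype.card_congr e]
  congr 1
  exact e.sum_comp fun ω => if p ω then (1 : ℝ) else 0

lemma unifProb_fst [Nonempty Ω'] (p : Ω → Prop) :
    unifProb (fun ω : Ω × Ω' => p ω.1) = unifProb p := by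
  classical
  have hc : (Fintype.card Ω' : ℝ) ≠ 0 := by simp
  rw [unifProb_eq_sum, unifProb_eq_sum, Fintype.sum_prod_type]
  have h (x : Ω) : (∑ y : Ω', if p (x, y).1 then (1 : ℝ) else 0)
      = Fintype.card Ω' * if p x then 1 else 0 := by
    by_cases hx : p x <;> simp [hx]
  rw [Finset.sum_congr rfl fun x _ => h x, ← Finset.mul_sum, Fintype.card_prod, Nat.cast_mul,
    mul_comm (Fintype.card Ω : ℝ), mul_div_mul_left _ _ hc]

end UniformProbability

/-! ### Subadditivity of influence and distance from juntas. -/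

section Influence

variable {n : ℕ}

/-- Exchange the coordinates in `A` between two points. -/
def exchange (A : Finset (Fin n)) :
    (Fin n → Bool) × (Fin n → Bool) ≃ (Fin n → Bool) × (Fin n → Bool) where
  toFun x := (A.piecewise x.2 x.1, A.piecewise x.1 x.2)
  invFun x := (A.piecewise x.2 x.1, A.piecewise x.1 x.2)
  left_inv x := by
    ext i <;> by_cases h : i ∈ A <;> simp [h]
  right_inv x := by
    ext i <;> by_cases h : i ∈ A <;> simp [h]

lemma influence_nonneg (f : (Fin n → Bool) → Bool) (A : Finset (Fin n)) : 0 ≤ influence f A :=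
  unifProb_nonneg _

/-- Resample `A`, then `B` from a fresh point: if `f` changes overall, it changes at one of the two
steps. The intermediate point is again uniform, because `exchange A` permutes the pairs. -/
lemma influence_union_le (f : (Fin n → Bool) → Bool) (A B : Finset (Fin n)) :
    influence f (A ∪ B) ≤ influence f A + influence f B := by
  have hA : unifProb (fun w : ((Fin n → Bool) × (Fin n → Bool)) × (Fin n → Bool) =>
      f w.1.1 ≠ f (A.piecewise w.1.2 w.1.1)) = influence f A :=
    unifProb_fst fun xy : (Fin n → Bool) × (Fin n → Bool) => f xy.1 ≠ f (A.piecewise xy.2 xy.1)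
  have hB : unifProb (fun w : ((Fin n → Bool) × (Fin n → Bool)) × (Fin n → Bool) =>
      f (A.piecewise w.1.2 w.1.1) ≠ f (B.piecewise w.2 (A.piecewise w.1.2 w.1.1)))
      = influence f B := by
    refine (unifProb_comp_equiv ((exchange A).prodCongr (Equiv.refl _))
      fun w : ((Fin n → Bool) × (Fin n → Bool)) × (Fin n → Bool) =>
        f w.1.1 ≠ f (B.piecewise w.2 w.1.1)).trans ?_
    refine (unifProb_comp_equiv (((Equiv.prodAssoc _ _ _).trans
      ((Equiv.refl _).prodCongr (Equiv.prodComm _ _))).trans (Equiv.prodAssoc _ _ _).symm)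
      fun w : ((Fin n → Bool) × (Fin n → Bool)) × (Fin n → Bool) =>
        f w.1.1 ≠ f (B.piecewise w.1.2 w.1.1)).trans ?_
    exact unifProb_fst
      fun xy : (Fin n → Bool) × (Fin n → Bool) => f xy.1 ≠ f (B.piecewise xy.2 xy.1)
  have hAB : unifProb (fun w : ((Fin n → Bool) × (Fin n → Bool)) × (Fin n → Bool) =>
      f w.1.1 ≠ f (B.piecewise w.2 (A.piecewise w.1.2 w.1.1))) = influence f (A ∪ B) := by
    have hpw (w : ((Fin n → Bool) × (Fin n → Bool)) × (Fin n → Bool)) :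
        B.piecewise w.2 (A.piecewise w.1.2 w.1.1)
          = (A ∪ B).piecewise (B.piecewise w.2 w.1.2) w.1.1 := by
      ext i
      by_cases hA : i ∈ A <;> by_cases hB : i ∈ B <;> simp [hA, hB]
    simp only [hpw]
    refine (unifProb_comp_equiv (((Equiv.prodAssoc _ _ _).trans
      ((Equiv.refl _).prodCongr (exchange B))).trans (Equiv.prodAssoc _ _ _).symm)
      fun w : ((Fin n → Bool) × (Fin n → Bool)) × (Fin n → Bool) =>
        f w.1.1 ≠ f ((A ∪ B).piecewise w.1.2 w.1.1)).trans ?_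
    exact unifProb_fst
      fun xy : (Fin n → Bool) × (Fin n → Bool) => f xy.1 ≠ f ((A ∪ B).piecewise xy.2 xy.1)
  rw [← hAB, ← hA, ← hB]
  refine le_trans (unifProb_mono fun w hw => ?_) (unifProb_or_le _ _)
  by_contra! h
  exact hw (h.1.trans h.2)

lemma influence_compl_inter_le (f : (Fin n → Bool) → Bool) (A B : Finset (Fin n)) :
    influence f (A ∩ B)ᶜ ≤ influence f Aᶜ + influence f Bᶜ := by
  rw [Finset.compl_inter]
  exact influence_union_le f _ _

/-- For each fixed `y`, overwriting `Jᶜ` by `y` turns `f` into a junta on `J`; average its distance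
from `f` over `y`. -/
lemma IsFar.le_influence_compl {k : ℕ} {ε : ℝ} {f : (Fin n → Bool) → Bool}
    (hf : IsFar ε (IsJunta k) f) {J : Finset (Fin n)} (hJ : J.card ≤ k) :
    ε ≤ influence f Jᶜ := by
  classical
  have hfar (y : Fin n → Bool) :
      ε * 2 ^ n ≤ ∑ x, if f x ≠ f (Jᶜ.piecewise y x) then (1 : ℝ) else 0 := by
    have h := hf (fun x => f (Jᶜ.piecewise y x)) ⟨J, hJ, fun x z hxz => congrArg f <| funext fun i => by
      by_cases hi : i ∈ J
      · rw [Finset.piecewise_eq_of_notMem _ _ _ (by simpa using hi),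
          Finset.piecewise_eq_of_notMem _ _ _ (by simpa using hi)]
        exact hxz i hi
      · rw [Finset.piecewise_eq_of_mem _ _ _ (by simpa using hi),
          Finset.piecewise_eq_of_mem _ _ _ (by simpa using hi)]⟩
    rw [Finset.sum_boole]
    simpa [hammingDist] using h
  have hcard : ε * (Fintype.card ((Fin n → Bool) × (Fin n → Bool)) : ℝ)
      = ∑ _y : Fin n → Bool, ε * 2 ^ n := by
    simp
    ring
  unfold influence
  rw [unifProb_eq_sum, Fintype.sum_prod_type_right, le_div_iff₀ (by positivity)]
  rw [hcard]
  refine Finset.sum_le_sum fun y _ => (hfar y).trans_eq (Finset.sum_congr rfl fun x _ => ?_)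
  congr

end Influence

/-! ### Biased measure of intersecting families. -/

section BiasedMeasure

open Classical in
/-- The `p`-biased measure of a set of points of the cube, each coordinate being `true`
independently with probability `p`. -/
noncomputable def biasedMeasure (p : ℝ) : {n : ℕ} → ((Fin n → Bool) → Prop) → ℝ
  | 0, A => if A Fin.elim0 then 1 else 0
  | _ + 1, A => (1 - p) * biasedMeasure p (fun x => A (Fin.cons false x)) +
      p * biasedMeasure p (fun x => A (Fin.cons true x))

variable {p : ℝ}

lemma biasedMeasure_nonneg (hp0 : 0 ≤ p) (hp1 : p ≤ 1) :
    ∀ {n : ℕ} (A : (Fin n → Bool) → Prop), 0 ≤ biasedMeasure p A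
  | 0, A => by unfold biasedMeasure; split_ifs <;> norm_num
  | n + 1, A => by
    have h0 := biasedMeasure_nonneg hp0 hp1 fun x => A (Fin.cons false x)
    have h1 := biasedMeasure_nonneg hp0 hp1 fun x => A (Fin.cons true x)
    have : 0 ≤ 1 - p := by linarith
    unfold biasedMeasure
    positivity

lemma biasedMeasure_le_one (hp0 : 0 ≤ p) (hp1 : p ≤ 1) :
    ∀ {n : ℕ} (A : (Fin n → Bool) → Prop), biasedMeasure p A ≤ 1
  | 0, A => by unfold biasedMeasure; split_ifs <;> norm_num
  | n + 1, A => by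
    have h0 := biasedMeasure_le_one hp0 hp1 fun x => A (Fin.cons false x)
    have h1 := biasedMeasure_le_one hp0 hp1 fun x => A (Fin.cons true x)
    unfold biasedMeasure
    nlinarith

lemma biasedMeasure_mono (hp0 : 0 ≤ p) (hp1 : p ≤ 1) :
    ∀ {n : ℕ} {A B : (Fin n → Bool) → Prop}, (∀ x, A x → B x) →
      biasedMeasure p A ≤ biasedMeasure p B
  | 0, A, B, h => by
    unfold biasedMeasure
    have := h Fin.elim0
    split_ifs <;> first | tauto | norm_num
  | n + 1, A, B, h => by
    have h0 := biasedMeasure_mono hp0 hp1 fun x => h (Fin.cons false x)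
    have h1 := biasedMeasure_mono hp0 hp1 fun x => h (Fin.cons true x)
    have : 0 ≤ 1 - p := by linarith
    unfold biasedMeasure
    gcongr

/-- The number of coordinates in which both points are `true`. -/
def commonCard {n : ℕ} (x y : Fin n → Bool) : ℕ :=
  (Finset.univ.filter fun i => x i = true ∧ y i = true).card

lemma commonCard_cons {n : ℕ} (a b : Bool) (x y : Fin n → Bool) :
    commonCard (Fin.cons a x : Fin (n + 1) → Bool) (Fin.cons b y)
      = (if a = true ∧ b = true then 1 else 0) + commonCard x y := by
  simp only [commonCard, Finset.card_filter, Fin.sum_univ_succ, Fin.cons_zero, Fin.cons_succ]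

/-- Any point of `A` and any point of `B` are both `true` in at least `t` common coordinates. -/
def CrossIntersecting {n : ℕ} (t : ℕ) (A B : (Fin n → Bool) → Prop) : Prop :=
  ∀ x y, A x → B y → t ≤ commonCard x y

/-- The inductive step for cross-intersecting families, whose measures on the two halves of the cube
are `a₀, a₁` and `b₀, b₁`. When `a₁ * b₁ > M`, multiplying the claim by `a₁ * b₁` leaves only the
three controlled products. -/
lemma biased_product_le {p a₀ a₁ b₀ b₁ M : ℝ} (hp0 : 0 < p) (hp : p ≤ 1 / 2)
    (ha : 0 ≤ a₀) (hb : 0 ≤ b₀) (haa : a₀ ≤ a₁) (hbb : b₀ ≤ b₁) (hM : 0 ≤ M)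
    (h01 : a₀ * b₁ ≤ M) (h10 : a₁ * b₀ ≤ M) (h11 : p ^ 2 * (a₁ * b₁) ≤ (1 - p) ^ 2 * M) :
    ((1 - p) * a₀ + p * a₁) * ((1 - p) * b₀ + p * b₁) ≤ M := by
  have hq : 0 ≤ 1 - p := by linarith
  have ha1 : 0 ≤ a₁ := ha.trans haa
  have hb1 : 0 ≤ b₁ := hb.trans hbb
  rcases le_or_gt (a₁ * b₁) M with hs | hs
  · refine le_trans (mul_le_mul ?_ ?_ (by positivity) ha1) hs
    · nlinarith [mul_le_mul_of_nonneg_left haa hq]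
    · nlinarith [mul_le_mul_of_nonneg_left hbb hq]
  · have hs0 : 0 < a₁ * b₁ := hM.trans_lt hs
    have h1 : ((1 - p) * a₀ + p * a₁) * b₁ ≤ (1 - p) * M + p * (a₁ * b₁) := by nlinarith
    have h2 : ((1 - p) * b₀ + p * b₁) * a₁ ≤ (1 - p) * M + p * (a₁ * b₁) := by nlinarith
    have h3 := mul_le_mul h1 h2 (by positivity) (by positivity)
    refine le_of_mul_le_mul_right ?_ hs0
    calc _ = ((1 - p) * a₀ + p * a₁) * b₁ * (((1 - p) * b₀ + p * b₁) * a₁) := by ring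
      _ ≤ _ := h3
      -- With `q = 1 - p` and `s = a₁ * b₁`, the identity `(q M + p s)² - M s = (M - s)(q² M - p²
      -- s)` holds since `p + q = 1`.
      _ ≤ M * (a₁ * b₁) := by
        nlinarith [mul_nonneg (sub_nonneg.2 hs.le) (sub_nonneg.2 h11)]

lemma cons_le_cons_bool {n : ℕ} {a b : Bool} {x y : Fin n → Bool} (hab : a ≤ b) (hxy : x ≤ y) :
    (Fin.cons a x : Fin (n + 1) → Bool) ≤ Fin.cons b y :=
  Fin.cons_le_cons.2 ⟨hab, hxy⟩

/-- Induction on `n` by fixing the first coordinate. Two families are needed because the sections of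
a single one differ. Only the true-true sections lose a common coordinate, at the cost of a factor
`(p / (1 - p)) ^ 2`; monotonicity makes the false-false pair unnecessary. -/
lemma CrossIntersecting.biasedMeasure_mul_le (hp0 : 0 < p) (hp : p ≤ 1 / 2) :
    ∀ {n : ℕ} (t : ℕ) {A B : (Fin n → Bool) → Prop}, Monotone A → Monotone B →
      CrossIntersecting t A B →
      biasedMeasure p A * biasedMeasure p B ≤ (p / (1 - p)) ^ (2 * t) := by
  have hp1 : p ≤ 1 := by linarith
  have hq : 0 < 1 - p := by linarith
  intro n
  induction n with
  | zero =>
    rintro (_ | t) A B - - hAB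
    · exact (mul_le_one₀ (biasedMeasure_le_one hp0.le hp1 A) (biasedMeasure_nonneg hp0.le hp1 B)
        (biasedMeasure_le_one hp0.le hp1 B)).trans (by simp)
    · have h : ¬ (A Fin.elim0 ∧ B Fin.elim0) := fun h => by
        simpa [commonCard] using hAB _ _ h.1 h.2
      have h0 : 0 ≤ (p / (1 - p)) ^ (2 * (t + 1)) := by positivity
      unfold biasedMeasure
      split_ifs <;> first | tauto | simpa using h0
  | succ n ih =>
    rintro (_ | t) A B hA hB hAB
    · exact (mul_le_one₀ (biasedMeasure_le_one hp0.le hp1 A) (biasedMeasure_nonneg hp0.le hp1 B)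
        (biasedMeasure_le_one hp0.le hp1 B)).trans (by simp)
    · have mono {D : (Fin (n + 1) → Bool) → Prop} (hD : Monotone D) (b : Bool) :
          Monotone fun x => D (Fin.cons b x) := fun x y hxy => hD (cons_le_cons_bool le_rfl hxy)
      have h01 := ih (t + 1) (mono hA false) (mono hB true) fun x y hx hy => by
        simpa [commonCard_cons] using hAB _ _ hx hy
      have h10 := ih (t + 1) (mono hA true) (mono hB false) fun x y hx hy => by
        simpa [commonCard_cons] using hAB _ _ hx hy
      have h11 := ih t (mono hA true) (mono hB true) fun x y hx hy => by
        have := hAB _ _ hx hy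
        rw [commonCard_cons] at this
        simp at this
        omega
      rw [biasedMeasure, biasedMeasure]
      refine biased_product_le hp0 hp (biasedMeasure_nonneg hp0.le hp1 _)
        (biasedMeasure_nonneg hp0.le hp1 _)
        (biasedMeasure_mono hp0.le hp1 fun x => hA (cons_le_cons_bool (by decide) le_rfl))
        (biasedMeasure_mono hp0.le hp1 fun x => hB (cons_le_cons_bool (by decide) le_rfl))
        (by positivity) h01 h10 ?_
      calc _ ≤ p ^ 2 * (p / (1 - p)) ^ (2 * t) := by gcongr
        _ = (1 - p) ^ 2 * (p / (1 - p)) ^ (2 * (t + 1)) := by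
          have h : (1 - p) ^ 2 * (p / (1 - p)) ^ 2 = p ^ 2 := by field_simp
          rw [← h]
          ring

/-- A `t`-intersecting family of subsets of `[n]` has `p`-biased measure at most
`(p / (1 - p)) ^ t`. -/
lemma CrossIntersecting.biasedMeasure_le (hp0 : 0 < p) (hp : p ≤ 1 / 2) {n t : ℕ}
    {A : (Fin n → Bool) → Prop} (hA : CrossIntersecting t A A) :
    biasedMeasure p A ≤ (p / (1 - p)) ^ t := by
  have hp1 : p ≤ 1 := by linarith
  have hq : 0 < 1 - p := by linarith
  -- The upward closure stays `t`-intersecting and is monotone, so the product bound applies to it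
  -- paired with itself.
  let B : (Fin n → Bool) → Prop := fun x => ∃ y ≤ x, A y
  have hB : Monotone B := fun x z hxz ⟨y, hy, hAy⟩ => ⟨y, hy.trans hxz, hAy⟩
  have hBB : CrossIntersecting t B B := by
    rintro x y ⟨x', hx, hAx⟩ ⟨y', hy, hAy⟩
    refine (hA x' y' hAx hAy).trans (Finset.card_le_card fun i => ?_)
    have h1 := hx i
    have h2 := hy i
    simp only [Finset.mem_filter, Finset.mem_univ, true_and]
    rintro ⟨h3, h4⟩
    rw [h3] at h1
    rw [h4] at h2
    exact ⟨top_le_iff.1 h1, top_le_iff.1 h2⟩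
  have h := hBB.biasedMeasure_mul_le hp0 hp t hB hB
  rw [pow_mul', ← pow_two] at h
  exact (biasedMeasure_mono hp0.le hp1 fun x hx => ⟨x, le_rfl, hx⟩).trans
    (le_of_sq_le_sq h (by positivity))

lemma unifProb_mem_eq_biasedMeasure {α : Type*} [Fintype α] [Nonempty α] [DecidableEq α]
    (T : Finset α) : ∀ {n : ℕ} (A : (Fin n → Bool) → Prop),
      unifProb (fun I : Fin n → α => A fun i => decide (I i ∈ T))
        = biasedMeasure ((T.card : ℝ) / Fintype.card α) A := by
  classical
  have hc : (Fintype.card α : ℝ) ≠ 0 := by simp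
  intro n
  induction n with
  | zero =>
    intro A
    rw [unifProb_eq_sum]
    simp [biasedMeasure, Subsingleton.elim _ (Fin.elim0 : Fin 0 → Bool)]
  | succ n ih =>
    intro A
    have hcons (a : α) (I : Fin n → α) :
        (fun i => decide ((Fin.cons a I : Fin (n + 1) → α) i ∈ T))
          = (Fin.cons (decide (a ∈ T)) fun i => decide (I i ∈ T)) := by
      ext i
      refine Fin.cases ?_ (fun j => ?_) i <;> simp
    have hsum (b : Bool) :
        (∑ I : Fin n → α, if A (Fin.cons b fun i => decide (I i ∈ T)) then (1 : ℝ) else 0)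
          = Fintype.card α ^ n * biasedMeasure ((T.card : ℝ) / Fintype.card α)
              (fun x => A (Fin.cons b x)) := by
      rw [← ih, unifProb_eq_sum]
      simp only [Fintype.card_fun, Fintype.card_fin, Nat.cast_pow]
      field_simp
    rw [unifProb_eq_sum, ← (Fin.consEquiv fun _ : Fin (n + 1) => α).sum_comp,
      Fintype.sum_prod_type]
    have hfiber (a : α) : (∑ I : Fin n → α, if A fun i =>
        decide ((Fin.consEquiv fun _ : Fin (n + 1) => α) (a, I) i ∈ T) then (1 : ℝ) else 0)
        = Fintype.card α ^ n * biasedMeasure ((T.card : ℝ) / Fintype.card α)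
            (fun x => A (Fin.cons (decide (a ∈ T)) x)) :=
      (Finset.sum_congr rfl fun I _ =>
        if_congr (iff_of_eq (congrArg A (hcons a I))) rfl rfl).trans (hsum (decide (a ∈ T)))
    rw [Finset.sum_congr rfl fun a _ => hfiber a]
    have hsplit (u : Bool → ℝ) :
        ∑ a : α, u (decide (a ∈ T)) = (Fintype.card α - T.card) * u false + T.card * u true := by
      have h1 (a : α) : u (decide (a ∈ T)) = u false + if a ∈ T then u true - u false else 0 := by
        split_ifs with h <;> simp [h]
      simp only [h1, Finset.sum_add_distrib, Finset.sum_ite_mem, Finset.univ_inter,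
        Finset.sum_const, Finset.card_univ, nsmul_eq_mul]
      ring
    rw [hsplit fun b => (Fintype.card α : ℝ) ^ n *
      biasedMeasure ((T.card : ℝ) / Fintype.card α) (fun x => A (Fin.cons b x))]
    simp only [Fintype.card_fun, Fintype.card_fin, Nat.cast_pow]
    rw [biasedMeasure]
    field_simp
    ring

end BiasedMeasure

/-! ### Random partitions: separation and unions of parts. -/

section RandomPartition

variable {n r : ℕ}

lemma unifProb_eq_le {i j : Fin n} (hij : i ≠ j) (hr : 0 < r) :
    unifProb (fun I : LabelledPartition n r => I i = I j) ≤ 1 / r := by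
  classical
  have : NeZero r := ⟨hr.ne'⟩
  have hcard : (Finset.univ.filter fun I : LabelledPartition n r => I i = I j).card * r
      ≤ Fintype.card (LabelledPartition n r) := by
    have h := Finset.card_le_card_of_injOn
      (s := (Finset.univ.filter fun I : LabelledPartition n r => I i = I j) ×ˢ
        (Finset.univ : Finset (Fin r)))
      (t := (Finset.univ : Finset (LabelledPartition n r)))
      -- Overwriting the label of `i` loses nothing, as it can be read off from `j`.
      (fun w => Function.update w.1 i w.2) (fun _ _ => Finset.mem_univ _) ?_
    · simpa [Finset.card_product] using h
    · rintro ⟨I, a⟩ hI ⟨I', a'⟩ hI' h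
      simp only [Finset.coe_product, Set.mem_prod, Finset.mem_coe, Finset.mem_filter,
        Finset.mem_univ, true_and, and_true] at hI hI' h
      have ha : a = a' := by simpa using congrFun h i
      have hne {l : Fin n} (hl : l ≠ i) : I l = I' l := by simpa [hl] using congrFun h l
      refine Prod.ext (funext fun l => ?_) ha
      by_cases hl : l = i
      · subst hl
        exact hI.trans ((hne hij.symm).trans hI'.symm)
      · exact hne hl
  unfold unifProb
  rw [div_le_div_iff₀ (by positivity) (by positivity), one_mul]
  norm_cast
  convert hcard

lemma unifProb_not_injOn_le (S : Finset (Fin n)) (hr : 0 < r) :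
    unifProb (fun I : LabelledPartition n r => ¬ Set.InjOn I S) ≤ (S.card : ℝ) ^ 2 / r := by
  classical
  calc unifProb (fun I : LabelledPartition n r => ¬ Set.InjOn I S)
      ≤ unifProb (fun I : LabelledPartition n r => ∃ w ∈ S.offDiag, I w.1 = I w.2) := by
        refine unifProb_mono fun I hI => ?_
        simp only [Set.InjOn, not_forall] at hI
        obtain ⟨i, hi, j, hj, h, hij⟩ := hI
        exact ⟨(i, j), Finset.mem_offDiag.2 ⟨hi, hj, hij⟩, h⟩
    _ ≤ ∑ w ∈ S.offDiag, unifProb (fun I : LabelledPartition n r => I w.1 = I w.2) :=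
        unifProb_exists_le_sum _ _
    _ ≤ ∑ w ∈ S.offDiag, (1 / r : ℝ) :=
        Finset.sum_le_sum fun w hw => unifProb_eq_le (Finset.mem_offDiag.1 hw).2.2 hr
    _ = (S.offDiag.card : ℝ) / r := by simp [div_eq_mul_inv]
    _ ≤ (S.card : ℝ) ^ 2 / r := by
        gcongr
        rw [Finset.offDiag_card, pow_two]
        exact_mod_cast Nat.sub_le _ _

lemma card_unionOfParts_inter_le {I : LabelledPartition n r} {S : Finset (Fin n)}
    (hI : Set.InjOn I S) (T : Finset (Fin r)) : (unionOfParts I T ∩ S).card ≤ T.card :=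
  Finset.card_le_card_of_injOn I (fun i hi => by simp [unionOfParts] at hi; exact hi.1)
    (hI.mono (by simp))

/-- If `F` is a `t`-intersecting family of subsets of `[n]`, then few partitions have a union of
parts with labels in `T` that belongs to `F`. -/
lemma unifProb_unionOfParts_le {t : ℕ} {F : Finset (Fin n) → Prop}
    (hF : ∀ J K, F J → F K → t ≤ (J ∩ K).card) {T : Finset (Fin r)} (hT : 0 < T.card)
    (hTr : 2 * T.card ≤ r) :
    unifProb (fun I : LabelledPartition n r => F (unionOfParts I T))
      ≤ (2 * (T.card / r : ℝ)) ^ t := by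
  have hr : 0 < r := by omega
  have : NeZero r := ⟨hr.ne'⟩
  have hTr' : 2 * (T.card : ℝ) ≤ r := by exact_mod_cast hTr
  have hp0 : 0 < (T.card / r : ℝ) := by positivity
  have hp : (T.card / r : ℝ) ≤ 1 / 2 := by
    rw [div_le_div_iff₀ (by positivity) (by positivity)]; linarith
  have h := unifProb_mem_eq_biasedMeasure T
    fun x : Fin n → Bool => F (Finset.univ.filter fun i => x i = true)
  simp only [decide_eq_true_eq, Fintype.card_fin] at h
  change unifProb (fun I : LabelledPartition n r => F (unionOfParts I T)) = _ at h
  rw [h]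
  have hcross : CrossIntersecting t
      (fun x : Fin n → Bool => F (Finset.univ.filter fun i => x i = true))
      (fun x : Fin n → Bool => F (Finset.univ.filter fun i => x i = true)) := fun x y hx hy => by
    simpa [commonCard, Finset.filter_and] using hF _ _ hx hy
  refine (hcross.biasedMeasure_le hp0 hp).trans ?_
  have hq : 0 < 1 - (T.card / r : ℝ) := by linarith
  gcongr
  rw [div_le_iff₀ hq]
  nlinarith

end RandomPartition

/-! ### Numerical estimates and the two cases. -/

lemma choose_le_exp_mul_pow {k r : ℕ} (hk : 1 ≤ k) :
    (r.choose k : ℝ) ≤ (Real.exp 1 * (r / k)) ^ k := by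
  have hk' : (0 : ℝ) < k := by exact_mod_cast hk
  have h := Real.pow_div_factorial_le_exp (k : ℝ) hk'.le k
  calc (r.choose k : ℝ) ≤ (r : ℝ) ^ k / k.factorial := Nat.choose_le_pow_div k r
    _ = (r / k : ℝ) ^ k * ((k : ℝ) ^ k / k.factorial) := by
      rw [div_pow]; field_simp
    _ ≤ (r / k : ℝ) ^ k * Real.exp k := by gcongr
    _ = (Real.exp 1 * (r / k)) ^ k := by
      rw [mul_pow, ← Real.exp_nat_mul, mul_one, mul_comm]

lemma choose_mul_pow_le {c : ℝ} (hc : 72 ≤ c) {k r : ℕ} (hk : 1 ≤ k)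
    (hr : (r : ℝ) = c * (k : ℝ) ^ 2) :
    (r.choose k : ℝ) * (2 * (k / r : ℝ)) ^ (2 * k) ≤ 1 / 6 := by
  have hk' : (1 : ℝ) ≤ k := by exact_mod_cast hk
  have hc0 : 0 < c := by linarith
  have he := Real.exp_one_lt_three
  have he0 := Real.exp_pos 1
  have hbase : Real.exp 1 * (r / k) * (2 * (k / r : ℝ)) ^ 2 ≤ 1 / 6 := by
    have : Real.exp 1 * (r / k) * (2 * (k / r : ℝ)) ^ 2 = 4 * Real.exp 1 / (c * k) := by
      rw [hr]; field_simp; norm_num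
    -- The constant 72 arises here: `4e < 12 = 72 / 6`.
    rw [this, div_le_div_iff₀ (by positivity) (by positivity)]
    nlinarith
  calc (r.choose k : ℝ) * (2 * (k / r : ℝ)) ^ (2 * k)
      ≤ (Real.exp 1 * (r / k)) ^ k * (2 * (k / r : ℝ)) ^ (2 * k) := by
        gcongr; exact choose_le_exp_mul_pow hk
    _ = (Real.exp 1 * (r / k) * (2 * (k / r : ℝ)) ^ 2) ^ k := by rw [pow_mul, ← mul_pow]
    _ ≤ Real.exp 1 * (r / k) * (2 * (k / r : ℝ)) ^ 2 :=
        pow_le_of_le_one (by positivity) (hbase.trans (by norm_num)) (by omega)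
    _ ≤ 1 / 6 := hbase

lemma unifProb_exists_influence_lt_le {c : ℝ} (hc : 72 ≤ c) {n k r : ℕ} (hk : 1 ≤ k)
    (hr : (r : ℝ) = c * (k : ℝ) ^ 2) {ε : ℝ} {f : (Fin n → Bool) → Bool}
    (hf : IsFar ε (IsJunta k) f) :
    unifProb (fun I : LabelledPartition n r => ∃ T ∈ Finset.univ.powersetCard k,
      influence f (unionOfParts I T)ᶜ < ε / 4) ≤ 1 / 6 := by
  have hk' : (1 : ℝ) ≤ k := by exact_mod_cast hk
  have hkr : 2 * (k : ℝ) ≤ r := by rw [hr]; nlinarith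
  have hkr' : 2 * k ≤ r := by exact_mod_cast hkr
  have hr0 : 0 < r := by omega
  by_cases hsmall : ∃ S : Finset (Fin n), S.card ≤ 2 * k ∧ influence f Sᶜ < ε / 2
  · obtain ⟨S, hS, hSf⟩ := hsmall
    calc _ ≤ unifProb (fun I : LabelledPartition n r => ¬ Set.InjOn I S) := by
          refine unifProb_mono fun I ⟨T, hT, hlt⟩ hI => ?_
          have h1 := hf.le_influence_compl (J := unionOfParts I T ∩ S)
            ((card_unionOfParts_inter_le hI T).trans (Finset.mem_powersetCard.1 hT).2.le)
          have h2 := influence_compl_inter_le f (unionOfParts I T) S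
          -- This forces `ε > 0`, so that `ε ≤ ε / 4 + ε / 2` is absurd.
          have h3 := influence_nonneg f Sᶜ
          linarith
      _ ≤ (S.card : ℝ) ^ 2 / r := unifProb_not_injOn_le S hr0
      _ ≤ (2 * k : ℝ) ^ 2 / r := by gcongr; exact_mod_cast hS
      -- The quotient equals `4 / c`.
      _ ≤ 1 / 6 := by
          rw [div_le_div_iff₀ (by positivity) (by positivity), hr]
          nlinarith
  · push Not at hsmall
    have hF (J K : Finset (Fin n)) (hJ : influence f Jᶜ < ε / 4) (hK : influence f Kᶜ < ε / 4) :
        2 * k ≤ (J ∩ K).card := by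
      by_contra! h
      have h1 := hsmall _ h.le
      have h2 := influence_compl_inter_le f J K
      linarith
    calc _ ≤ ∑ T ∈ (Finset.univ : Finset (Fin r)).powersetCard k,
          unifProb (fun I : LabelledPartition n r =>
            influence f (unionOfParts I T)ᶜ < ε / 4) := unifProb_exists_le_sum _ _
      _ ≤ ∑ T ∈ (Finset.univ : Finset (Fin r)).powersetCard k,
          (2 * (k / r : ℝ)) ^ (2 * k) := by
          refine Finset.sum_le_sum fun T hT => ?_
          obtain rfl := (Finset.mem_powersetCard.1 hT).2
          exact unifProb_unionOfParts_le (F := fun J => influence f Jᶜ < ε / 4) hF hk hkr'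
      _ = (r.choose k : ℝ) * (2 * (k / r : ℝ)) ^ (2 * k) := by simp
      _ ≤ 1 / 6 := choose_mul_pow_le hc hk hr

end JuntaTesting

theorem lemma4 :
    ∃ c₀ : ℝ, 0 < c₀ ∧ ∀ c : ℝ, c₀ ≤ c →
      ∀ (n k r : ℕ), 1 ≤ k → (r : ℝ) = c * (k : ℝ) ^ 2 →
      ∀ (ε : ℝ) (f : (Fin n → Bool) → Bool), JuntaTesting.IsFar ε (JuntaTesting.IsJunta k) f →
        5 / 6 ≤ JuntaTesting.unifProb fun I : JuntaTesting.LabelledPartition n r =>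
          ∀ T : Finset (Fin r), T.card = k →
            ε / 4 ≤ JuntaTesting.influence f (JuntaTesting.unionOfParts I T)ᶜ := by
  refine ⟨72, by norm_num, fun c hc n k r hk hr ε f hf => ?_⟩
  have hbad := JuntaTesting.unifProb_exists_influence_lt_le hc hk hr hf
  have hr0 : r ≠ 0 := by
    rintro rfl
    have hk' : (1 : ℝ) ≤ k := by exact_mod_cast hk
    norm_num at hr
    rcases hr with h | h
    · linarith
    · omega
  have : NeZero r := ⟨hr0⟩
  have hcompl := JuntaTesting.unifProb_not fun I : JuntaTesting.LabelledPartition n r =>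
    ∃ T ∈ Finset.univ.powersetCard k,
      JuntaTesting.influence f (JuntaTesting.unionOfParts I T)ᶜ < ε / 4
  have hle : 5 / 6 ≤ JuntaTesting.unifProb fun I : JuntaTesting.LabelledPartition n r =>
      ¬ ∃ T ∈ Finset.univ.powersetCard k,
        JuntaTesting.influence f (JuntaTesting.unionOfParts I T)ᶜ < ε / 4 := by
    linarith
  refine hle.trans (JuntaTesting.unifProb_mono fun I hI T hT => ?_)
  by_contra! h
  exact hI ⟨T, Finset.mem_powersetCard.2 ⟨Finset.subset_univ _, hT⟩, h⟩
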